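/- There is a deterministic algorithm which, given a finite simple undirected graph $G=(V,E)$ with $n$ vertices, decides the three domatic number problem, i.e. whether $V$ can be partitioned into three pairwise disjoint dominating sets $V=D_1\cup D_2\cup D_3$ (a set $D\subseteq V$ is dominating if every vertex of $G$ belongs to $D$ or has a neighbour in $D$), and whose worst-case running time, on a random access machine with logarithmic cost that is given the adjacency matrix of $G$, is $\tilde{\mathcal{O}}(2.9416^n)$. Here $f\in\tilde{\mathcal{O}}(g)$ means that $f\in\mathcal{O}(q\cdot g)$ for some polynomial $q$. -/

import Mathlib

/-! ### Dominating sets and domatic partitions -/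

/-- `D` is a dominating set of `G`: every vertex belongs to `D` or has a neighbour in `D`. -/
def IsDominatingSet {V : Type*} (G : SimpleGraph V) (D : Set V) : Prop :=
  ∀ v, v ∈ D ∨ ∃ u ∈ D, G.Adj v u

/-- The vertex set of `G` can be partitioned into `k` pairwise disjoint dominating sets. -/
def HasDomaticPartition {V : Type*} (G : SimpleGraph V) (k : ℕ) : Prop :=
  ∃ D : Fin k → Set V,
    (⋃ i, D i) = Set.univ ∧ (∀ i j, i ≠ j → Disjoint (D i) (D j)) ∧
      ∀ i, IsDominatingSet G (D i)

/-! ### Random access machines with logarithmic cost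

Programs for a random access machine, written in structured form. A state consists of registers
`reg 0, reg 1, …` (a program mentions finitely many of them, by name) and a memory that is
addressed indirectly; every cell holds a natural number. The cost is logarithmic: handling a
number costs its binary length. -/

namespace RAM

/-- The state of the machine: register contents and memory contents. -/
structure State where
  reg : ℕ → ℕ
  mem : ℕ → ℕ

/-- The arithmetic operations (subtraction is truncated at `0`, division is rounded down). -/
inductive Op where
  | add
  | sub
  | mul
  | div

/-- The result of an arithmetic operation. -/
def Op.apply : Op → ℕ → ℕ → ℕ
  | .add, a, b => a + b
  | .sub, a, b => a - b
  | .mul, a, b => a * b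
  | .div, a, b => a / b

/-- Expressions: constants, registers, memory reads and arithmetic. -/
inductive Expr where
  | const (c : ℕ)
  | reg (x : ℕ)
  | mem (a : Expr)
  | op (o : Op) (a b : Expr)

/-- The value of an expression in a state. -/
def Expr.val (s : State) : Expr → ℕ
  | .const c => c
  | .reg x => s.reg x
  | .mem a => s.mem (a.val s)
  | .op o a b => o.apply (a.val s) (b.val s)

/-- The cost of handling the number `k`: its length in binary, plus one. -/
def len (k : ℕ) : ℕ := Nat.size k + 1

/-- The cost of evaluating an expression: the lengths of all numbers that occur in the evaluation
(constants, register contents, addresses, memory contents, operands and results). -/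
def Expr.cost (s : State) : Expr → ℕ
  | .const c => len c
  | .reg x => len (s.reg x)
  | .mem a => a.cost s + len (s.mem (a.val s))
  | .op o a b => a.cost s + b.cost s + len (o.apply (a.val s) (b.val s))

/-- Programs. -/
inductive Program where
  | skip
  /-- `reg x := e` -/
  | assign (x : ℕ) (e : Expr)
  /-- `mem a := e` -/
  | store (a e : Expr)
  | seq (p q : Program)
  /-- if `e ≠ 0` then `p` else `q` -/
  | ite (e : Expr) (p q : Program)
  /-- while `e ≠ 0` do `p` -/
  | while (e : Expr) (p : Program)

/-- `Exec p s s' t`: started in the state `s`, the program `p` halts in the state `s'` after a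
computation of total cost `t`. -/
inductive Exec : Program → State → State → ℕ → Prop where
  | skip (s : State) : Exec .skip s s 1
  | assign (x : ℕ) (e : Expr) (s : State) :
      Exec (.assign x e) s { s with reg := Function.update s.reg x (e.val s) } (e.cost s + 1)
  | store (a e : Expr) (s : State) :
      Exec (.store a e) s { s with mem := Function.update s.mem (a.val s) (e.val s) }
        (a.cost s + e.cost s + 1)
  | seq {p q : Program} {s s' s'' : State} {t t' : ℕ} :
      Exec p s s' t → Exec q s' s'' t' → Exec (.seq p q) s s'' (t + t')
  | ite_true {e : Expr} {p q : Program} {s s' : State} {t : ℕ} :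
      e.val s ≠ 0 → Exec p s s' t → Exec (.ite e p q) s s' (e.cost s + t + 1)
  | ite_false {e : Expr} {p q : Program} {s s' : State} {t : ℕ} :
      e.val s = 0 → Exec q s s' t → Exec (.ite e p q) s s' (e.cost s + t + 1)
  | while_true {e : Expr} {p : Program} {s s' s'' : State} {t t' : ℕ} :
      e.val s ≠ 0 → Exec p s s' t → Exec (.while e p) s' s'' t' →
        Exec (.while e p) s s'' (e.cost s + t + t' + 1)
  | while_false {e : Expr} {p : Program} {s : State} :
      e.val s = 0 → Exec (.while e p) s s (e.cost s + 1)

open Classical in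
/-- The initial state for a graph with vertices `0, …, n - 1`: register `0` holds `n`, the memory
cell `i * n + j` holds the `(i, j)` entry of the adjacency matrix, and everything else is `0`. -/
noncomputable def graphInput {n : ℕ} (G : SimpleGraph (Fin n)) : State where
  reg := fun x => if x = 0 then n else 0
  mem := fun a => if ∃ i j : Fin n, a = i * n + j ∧ G.Adj i j then 1 else 0

open Classical in
/-- The program `p` decides the graph problem `Q` in time `T`, where time is measured as a function
of the number of vertices: on every graph with `n` vertices it halts with cost at most `T n`, with
the answer in register `0`, which is `1` for yes and `0` for no. -/
def DecidesInTime (p : Program) (Q : ∀ n : ℕ, SimpleGraph (Fin n) → Prop) (T : ℕ → ℕ) : Prop :=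
  ∀ (n : ℕ) (G : SimpleGraph (Fin n)), ∃ (s : State) (t : ℕ),
    Exec p (graphInput G) s t ∧ t ≤ T n ∧ s.reg 0 = if Q n G then 1 else 0

end RAM

/-- `f ∈ Õ(g)`: there is a polynomial `q` with `f ∈ O(q · g)`. -/
def IsSoftO (f g : ℕ → ℝ) : Prop :=
  ∃ q : Polynomial ℝ, f =O[Filter.atTop] fun n : ℕ => q.eval (n : ℝ) * g n

/-! The vertex set splits into three dominating sets exactly when some triple of dominating sets has
union `V` and sizes adding up to `n`, since such a cover is automatically disjoint
(`hasDomaticPartition_three_iff`). These triples are counted by inclusion-exclusion over subsets, at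
cost `2 ^ n` times a polynomial, which is below the required bound because `2 < 2.9416`.

A dominating set `D` gets the weight `z ^ |D|`. For each `S`, the cube of the total weight of the
dominating subsets of `S` is the weighted sum over triples with union inside `S` (`maskSum_cube`),
and Möbius inversion leaves, at `S = V`, the triples with union exactly `V`. No exponent there is
below `n`, and `z = 8 ^ n + 1` exceeds the number of triples, so no carries occur and the base-`z`
digit at `z ^ n` counts the ordered partitions (`tripleSum_div_mod_ne_zero_iff`).

Summation over subsets and its inverse each proceed one vertex at a time (`maskSum_insert`), hence
in `n` in-place sweeps over a table of `2 ^ n` entries (`runs_transformProgram`). Every stored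
number is at most `z ^ (3 * n + 1)`, so its length is quadratic in `n`, and logarithmic cost adds
only a polynomial factor. In the cost analysis `Runs` splits off a constant depending on the program
alone from a bound `A`, which carries the number length and the iteration counts. -/

namespace RAM

/-! ### Cost bounds for programs -/

theorem len_pos (k : ℕ) : 1 ≤ len k := by simp [len]

theorem len_mono {a b : ℕ} (h : a ≤ b) : len a ≤ len b := by
  simpa [len] using Nat.size_le_size h

theorem len_le_self (c : ℕ) : len c ≤ c + 1 := by
  simpa [len] using Nat.size_le.2 c.lt_two_pow_self

/-- The extra one in each `len` absorbs a possible carry, so every operation is subadditive in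
length. -/
theorem len_add_le (a b : ℕ) : len (a + b) ≤ len a + len b := by
  have ha := Nat.lt_size_self a
  have hb := Nat.lt_size_self b
  have h : Nat.size (a + b) ≤ Nat.size a + Nat.size b + 1 := by
    rw [Nat.size_le]
    have h1 : 2 ^ a.size ≤ 2 ^ (a.size + b.size) := Nat.pow_le_pow_right (by norm_num) (by omega)
    have h2 : 2 ^ b.size ≤ 2 ^ (a.size + b.size) := Nat.pow_le_pow_right (by norm_num) (by omega)
    rw [pow_succ]
    omega
  simp only [len]
  omega

theorem len_mul_le (a b : ℕ) : len (a * b) ≤ len a + len b := by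
  have ha := Nat.lt_size_self a
  have hb := Nat.lt_size_self b
  have h : Nat.size (a * b) ≤ Nat.size a + Nat.size b := by
    rw [Nat.size_le, pow_add]
    exact Nat.mul_lt_mul'' ha hb
  simp only [len]
  omega

theorem len_apply_le (o : Op) (a b : ℕ) : len (o.apply a b) ≤ len a + len b := by
  cases o
  · exact len_add_le a b
  · exact (len_mono (Nat.sub_le a b)).trans (Nat.le_add_right _ _)
  · exact len_mul_le a b
  · exact (len_mono (Nat.div_le_self a b)).trans (Nat.le_add_right _ _)

/-- All numbers in the state have length at most `L`. -/
def State.Bounded (L : ℕ) (s : State) : Prop :=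
  (∀ x, len (s.reg x) ≤ L) ∧ ∀ a, len (s.mem a) ≤ L

/-- The length of the value of an expression, in units of the length of the numbers in the
state. -/
def Expr.lengthFactor : Expr → ℕ
  | .const c => c + 1
  | .reg _ => 1
  | .mem _ => 1
  | .op _ a b => a.lengthFactor + b.lengthFactor

/-- The cost of an expression, in units of the length of the numbers in the state. -/
def Expr.costFactor : Expr → ℕ
  | .const c => c + 1
  | .reg _ => 1
  | .mem a => a.costFactor + 1
  | .op _ a b => a.costFactor + b.costFactor + (a.lengthFactor + b.lengthFactor)

theorem State.Bounded.one_le {L : ℕ} {s : State} (h : s.Bounded L) : 1 ≤ L :=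
  (len_pos _).trans (h.1 0)

theorem Expr.len_val_le {L : ℕ} {s : State} (h : s.Bounded L) (e : Expr) :
    len (e.val s) ≤ e.lengthFactor * L := by
  induction e with
  | const c =>
    exact (len_le_self c).trans (Nat.le_mul_of_pos_right _ h.one_le)
  | reg x => simpa [Expr.val, Expr.lengthFactor] using h.1 x
  | mem a => simpa [Expr.val, Expr.lengthFactor] using h.2 _
  | op o a b iha ihb =>
    simp only [Expr.val, Expr.lengthFactor, add_mul]
    exact (len_apply_le _ _ _).trans (add_le_add iha ihb)

theorem Expr.cost_le {L : ℕ} {s : State} (h : s.Bounded L) (e : Expr) :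
    e.cost s ≤ e.costFactor * L := by
  induction e with
  | const c =>
    exact (len_le_self c).trans (Nat.le_mul_of_pos_right _ h.one_le)
  | reg x => simpa [Expr.cost, Expr.costFactor] using h.1 x
  | mem a ih =>
    simp only [Expr.cost, Expr.costFactor, add_mul, one_mul]
    exact add_le_add ih (h.2 _)
  | op o a b iha ihb =>
    have := (Expr.op o a b).len_val_le h
    simp only [Expr.val, Expr.lengthFactor, add_mul] at this
    simp only [Expr.cost, Expr.costFactor, add_mul]
    omega

/-- A constant for the cost of a program, in units that account for the length of the numbers and
the numbers of iterations of the loops. -/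
def Program.costFactor : Program → ℕ
  | .skip => 1
  | .assign _ e => e.costFactor + 1
  | .store a e => a.costFactor + e.costFactor + 1
  | .seq p q => p.costFactor + q.costFactor
  | .ite e p q => e.costFactor + p.costFactor + q.costFactor + 1
  | .while e p => e.costFactor + p.costFactor + 1

/-- Started in `s`, the program `p` halts in `s'`, with cost at most `A` in units of the cost
factor of `p`. -/
def Runs (p : Program) (s s' : State) (A : ℕ) : Prop :=
  ∃ t ≤ p.costFactor * A, Exec p s s' t

theorem Runs.mono {p : Program} {s s' : State} {A A' : ℕ} (h : Runs p s s' A) (hA : A ≤ A') :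
    Runs p s s' A' :=
  let ⟨t, ht, he⟩ := h
  ⟨t, ht.trans (Nat.mul_le_mul_left _ hA), he⟩

/-- Cost factors add under composition, so one common `A` serves both halves; `Runs.mono` brings
phases to a common `A`. -/
theorem Runs.seq {p q : Program} {s s' s'' : State} {A : ℕ} (h : Runs p s s' A)
    (h' : Runs q s' s'' A) : Runs (.seq p q) s s'' A :=
  let ⟨t, ht, he⟩ := h
  let ⟨t', ht', he'⟩ := h'
  ⟨t + t', by rw [Program.costFactor, add_mul]; exact add_le_add ht ht', .seq he he'⟩

/-! ### Runs on explicit register lists -/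

/-- The state with registers `l`, followed by zeros, and memory `m`. -/
def mkState (l : List ℕ) (m : ℕ → ℕ) : State where
  reg := fun x => l.getD x 0
  mem := m

theorem bounded_mkState {B : ℕ} {l : List ℕ} {m : ℕ → ℕ} (hl : ∀ a ∈ l, a ≤ B)
    (hm : ∀ a, m a ≤ B) : (mkState l m).Bounded (len B) := by
  refine ⟨fun x => len_mono ?_, fun a => len_mono (hm a)⟩
  by_cases hx : x < l.length
  · simpa [mkState, hx] using hl _ (List.getElem_mem hx)
  · simp [mkState, not_lt.1 hx]

theorem Runs.assign {x : ℕ} {e : Expr} {l : List ℕ} {m : ℕ → ℕ} {L A v : ℕ}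
    (hs : (mkState l m).Bounded L) (hx : x < l.length) (hv : e.val (mkState l m) = v)
    (hA : L ≤ A) :
    Runs (.assign x e) (mkState l m) (mkState (l.set x v) m) A := by
  refine ⟨e.cost (mkState l m) + 1, ?_, ?_⟩
  · have := e.cost_le hs
    have := hs.one_le
    rw [Program.costFactor]
    nlinarith [Nat.mul_le_mul_left e.costFactor hA]
  · convert Exec.assign x e (mkState l m) using 1
    simp only [mkState, State.mk.injEq, and_true]
    funext y
    by_cases hy : y = x
    · subst hy
      simp [hx, ← hv, mkState]
    · simp [hy, List.getD, List.getElem?_set_ne (Ne.symm hy)]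

theorem Runs.assign_const {x c : ℕ} {l : List ℕ} {m : ℕ → ℕ} {L A : ℕ}
    (hs : (mkState l m).Bounded L) (hx : x < l.length) (hA : L ≤ A) :
    Runs (.assign x (.const c)) (mkState l m) (mkState (l.set x c) m) A :=
  Runs.assign hs hx rfl hA

theorem Runs.store {a e : Expr} {l : List ℕ} {m : ℕ → ℕ} {L A i v : ℕ}
    (hs : (mkState l m).Bounded L) (hi : a.val (mkState l m) = i)
    (hv : e.val (mkState l m) = v) (hA : L ≤ A) :
    Runs (.store a e) (mkState l m) (mkState l (Function.update m i v)) A := by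
  refine ⟨a.cost (mkState l m) + e.cost (mkState l m) + 1, ?_, ?_⟩
  · have := e.cost_le hs
    have := a.cost_le hs
    have := hs.one_le
    rw [Program.costFactor]
    nlinarith [Nat.mul_le_mul_left e.costFactor hA, Nat.mul_le_mul_left a.costFactor hA]
  · convert Exec.store a e (mkState l m) using 1
    simp [mkState, ← hi, ← hv]

/-- `while x < y do (p; x := x + 1)`, then `x := 0`, for registers `x` and `y`. -/
def forLoop (x y : ℕ) (p : Program) : Program :=
  .seq (.while (.op .sub (.reg y) (.reg x)) (.seq p (.assign x (.op .add (.reg x) (.const 1)))))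
    (.assign x (.const 0))

/-- The invariant comes in two forms: `l j` before round `j`, and `l' j` after the body but before
the counter increases. The final reset of the counter lets nested loops and later phases start from
the same registers. -/
theorem Runs.forLoop {x y : ℕ} {p : Program} {N L A : ℕ} (l l' : ℕ → List ℕ)
    (m : ℕ → ℕ → ℕ) (hb : ∀ j ≤ N, (mkState (l j) (m j)).Bounded L)
    (hb' : ∀ j < N, (mkState (l' j) (m (j + 1))).Bounded L)
    (hlen : x < (l N).length) (hlen' : ∀ j < N, x < (l' j).length)
    (hx : ∀ j ≤ N, (l j).getD x 0 = j) (hy : ∀ j ≤ N, (l j).getD y 0 = N)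
    (hx' : ∀ j < N, (l' j).getD x 0 = j) (hl' : ∀ j < N, (l' j).set x (j + 1) = l (j + 1))
    (hA : L ≤ A)
    (hp : ∀ j < N, Runs p (mkState (l j) (m j)) (mkState (l' j) (m (j + 1))) A) :
    Runs (forLoop x y p) (mkState (l 0) (m 0)) (mkState ((l N).set x 0) (m N))
      ((N + 1) * A) := by
  have hA1 : 1 ≤ A := ((hb 0 (Nat.zero_le _)).one_le).trans hA
  -- Besides the body, a round costs at most 4 for the test, 7 for the increment and 1 for the loop
  -- itself, in units of `A`; the failing last test costs 4 + 1.
  have key : ∀ d j, j + d = N → ∃ t ≤ (p.costFactor + 12) * (d * A) + 5 * A,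
      Exec (.while (.op .sub (.reg y) (.reg x))
        (.seq p (.assign x (.op .add (.reg x) (.const 1)))))
        (mkState (l j) (m j)) (mkState (l N) (m N)) t := by
    intro d
    induction d with
    | zero =>
      intro j hj
      obtain rfl : j = N := by simpa using hj
      refine ⟨_, ?_, .while_false ?_⟩
      · have := Expr.cost_le (hb j le_rfl) (.op .sub (.reg y) (.reg x))
        simp only [Expr.costFactor, Expr.lengthFactor] at this
        have := (hb j le_rfl).one_le
        nlinarith
      · change (l j).getD y 0 - (l j).getD x 0 = 0
        rw [hx j le_rfl, hy j le_rfl, Nat.sub_self]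
    | succ d ih =>
      intro j hj
      have hjN : j < N := by omega
      obtain ⟨t, ht, het⟩ := ih (j + 1) (by omega)
      have hstep : Runs (.assign x (.op .add (.reg x) (.const 1)))
          (mkState (l' j) (m (j + 1))) (mkState (l (j + 1)) (m (j + 1))) A := by
        rw [← hl' j hjN]
        refine Runs.assign (hb' j hjN) (hlen' j hjN) ?_ hA
        change (l' j).getD x 0 + 1 = j + 1
        rw [hx' j hjN]
      obtain ⟨t', ht', het'⟩ := Runs.seq (hp j hjN) hstep
      refine ⟨_, ?_, .while_true ?_ het' het⟩
      · have := Expr.cost_le (hb j hjN.le) (.op .sub (.reg y) (.reg x))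
        simp only [Program.costFactor, Expr.costFactor, Expr.lengthFactor] at this ht'
        have := (hb j hjN.le).one_le
        nlinarith
      · change (l j).getD y 0 - (l j).getD x 0 ≠ 0
        rw [hx j hjN.le, hy j hjN.le]
        omega
  obtain ⟨t, ht, he⟩ := key N 0 (by simp)
  obtain ⟨t', ht', he'⟩ := Runs.assign_const (c := 0) (hb N le_rfl) hlen hA
  refine ⟨_, ?_, .seq he he'⟩
  simp only [RAM.forLoop, Program.costFactor, Expr.costFactor, Expr.lengthFactor] at ht' ⊢
  nlinarith [Nat.zero_le (p.costFactor * A), Nat.zero_le (p.costFactor * (N * A)), Nat.zero_le (N * A)]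

end RAM

/-! ### Partial subset sums over binary masks -/

theorem Nat.testBit_sub_two_pow {S i : ℕ} (h : S.testBit i = true) (j : ℕ) :
    (S - 2 ^ i).testBit j = (S.testBit j && decide (j ≠ i)) := by
  have hle : 2 ^ i ≤ S := Nat.ge_two_pow_of_testBit h
  obtain ⟨X, rfl⟩ := Nat.exists_eq_add_of_le hle
  rw [Nat.testBit_two_pow_add_eq] at h
  rw [Nat.add_sub_cancel_left]
  rcases lt_trichotomy j i with hj | rfl | hj
  · simp [Nat.testBit_two_pow_add_gt hj, hj.ne]
  · simpa using h
  -- Bit `i` of `X` is zero, so adding `2 ^ i` produces no carry into the higher bits.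
  · have hX : X / 2 ^ (i + 1) = (2 ^ i + X) / 2 ^ (i + 1) := by
      have h0 : X / 2 ^ i % 2 = 0 := by
        rw [← Nat.toNat_testBit]
        simpa using h
      rw [pow_succ, ← Nat.div_div_eq_div_mul, ← Nat.div_div_eq_div_mul,
        Nat.add_div_left _ (by positivity)]
      omega
    obtain ⟨d, rfl⟩ := Nat.exists_eq_add_of_lt hj
    have h1 := Nat.testBit_div_two_pow (n := i + 1) X d
    have h2 := Nat.testBit_div_two_pow (n := i + 1) (2 ^ i + X) d
    rw [show i + d + 1 = d + (i + 1) by ring, ← h1, ← h2, hX]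
    simp [show d + (i + 1) ≠ i by omega]

/-- The mask `D` is contained in the mask `S`, and agrees with it outside the positions `J`. -/
def MaskLE (J : Set ℕ) (D S : ℕ) : Prop :=
  ∀ j, (D.testBit j = true → S.testBit j = true) ∧
    (j ∉ J → S.testBit j = true → D.testBit j = true)

/-- Freeing position `i` adds exactly the masks that omit `i` although `S` contains it; these are
compared with `S` without `i`. -/
theorem maskLE_insert {J : Set ℕ} {i : ℕ} (hi : i ∉ J) {D S : ℕ} :
    MaskLE (insert i J) D S ↔
      MaskLE J D S ∨ S.testBit i = true ∧ MaskLE J D (S - 2 ^ i) := by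
  constructor
  · intro h
    by_cases hc : S.testBit i = true ∧ D.testBit i = false
    · refine .inr ⟨hc.1, fun j => ?_⟩
      rw [Nat.testBit_sub_two_pow hc.1]
      by_cases hj : j = i
      · subst hj
        simp [hc.2]
      · simpa [hj] using h j
    · refine .inl fun j => ?_
      by_cases hj : j = i
      · subst hj
        have := (h j).1
        grind
      · simpa [hj] using h j
  · rintro (h | ⟨hS, h⟩) j
    · have := h j
      grind
    · have := h j
      rw [Nat.testBit_sub_two_pow hS] at this
      grind

theorem not_maskLE_and {J : Set ℕ} {i : ℕ} (hi : i ∉ J) {D S : ℕ} (hS : S.testBit i = true)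
    (h : MaskLE J D S) (h' : MaskLE J D (S - 2 ^ i)) : False := by
  have h1 := (h i).2 hi hS
  have h2 := (h' i).1 h1
  rw [Nat.testBit_sub_two_pow hS] at h2
  simp at h2

open Classical in
/-- The sum of the weights `W x` of all `x ∈ X` with `MaskLE J (u x) S`. -/
noncomputable def maskSum {ι : Type*} (X : Finset ι) (u W : ι → ℕ) (J : Set ℕ) (S : ℕ) : ℕ :=
  ∑ x ∈ X with MaskLE J (u x) S, W x

/-- One step of the fast subset-sum transform. Enlarging `J` sums over subsets; read backwards, it
is Möbius inversion. If `i` is not in `S`, then `S - 2 ^ i` is meaningless, but its factor is `0`.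
-/
theorem maskSum_insert {ι : Type*} (X : Finset ι) (u W : ι → ℕ) {J : Set ℕ} {i : ℕ}
    (hi : i ∉ J) (S : ℕ) :
    maskSum X u W (insert i J) S =
      maskSum X u W J S + S / 2 ^ i % 2 * maskSum X u W J (S - 2 ^ i) := by
  classical
  rw [← Nat.toNat_testBit]
  unfold maskSum
  cases hS : S.testBit i
  · simp [maskLE_insert hi, hS]
  · simp only [maskLE_insert hi, hS, true_and, Bool.toNat_true, one_mul, Finset.filter_or]
    rw [Finset.sum_union]
    rw [Finset.disjoint_filter]
    exact fun x _ h h' => not_maskLE_and hi hS h h'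

theorem maskSum_le {ι : Type*} (X : Finset ι) (u W : ι → ℕ) (J : Set ℕ) (S : ℕ) {b : ℕ}
    (h : ∀ x ∈ X, W x ≤ b) : maskSum X u W J S ≤ X.card * b := by
  classical
  unfold maskSum
  exact (Finset.sum_le_card_nsmul _ _ b fun x hx => h x (Finset.filter_subset _ _ hx)).trans
    (Nat.mul_le_mul_right _ (Finset.card_filter_le _ _))

theorem maskLE_empty {D S : ℕ} : MaskLE ∅ D S ↔ D = S := by
  constructor
  · intro h
    refine Nat.eq_of_testBit_eq fun j => ?_
    have := h j
    grind
  · rintro rfl j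
    simp

theorem maskLE_univ {D S : ℕ} : MaskLE Set.univ D S ↔
    ∀ j, D.testBit j = true → S.testBit j = true := by
  simp [MaskLE]

theorem maskLE_Iio {n D S : ℕ} (hS : S < 2 ^ n) :
    MaskLE (Set.Iio n) D S ↔ MaskLE Set.univ D S := by
  refine forall_congr' fun j => ?_
  by_cases hj : j < n
  · simp [hj]
  · have : S.testBit j = false :=
      Nat.testBit_lt_two_pow (hS.trans_le (Nat.pow_le_pow_right (by norm_num) (by omega)))
    simp [this]

/-- Only positions beyond the `n` bits are free, so the inversion is complete. -/
theorem maskLE_Ici {n D : ℕ} (hD : D < 2 ^ n) :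
    MaskLE (Set.Ici n) D (2 ^ n - 1) ↔ D = 2 ^ n - 1 := by
  constructor
  · intro h
    refine Nat.eq_of_testBit_eq fun j => ?_
    have hj' := h j
    by_cases hj : j < n
    · simp only [Nat.testBit_two_pow_sub_one, Set.mem_Ici, hj] at hj' ⊢
      grind
    · have : D.testBit j = false :=
        Nat.testBit_lt_two_pow (hD.trans_le (Nat.pow_le_pow_right (by norm_num) (by omega)))
      simp [this, hj]
  · rintro rfl j
    simp

/-- Three masks all lie inside `S` exactly when their union does. -/
theorem maskSum_cube (X : Finset ℕ) (w : ℕ → ℕ) (S : ℕ) :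
    maskSum X id w Set.univ S * maskSum X id w Set.univ S * maskSum X id w Set.univ S =
      maskSum (X ×ˢ X ×ˢ X) (fun x => x.1 ||| x.2.1 ||| x.2.2)
        (fun x => w x.1 * (w x.2.1 * w x.2.2)) Set.univ S := by
  classical
  unfold maskSum
  rw [mul_assoc, Finset.sum_mul_sum,
    ← Finset.sum_product' _ _ fun a b => w a * w b, Finset.sum_mul_sum,
    ← Finset.sum_product' _ _ fun a (b : ℕ × ℕ) => w a * (w b.1 * w b.2)]
  refine Finset.sum_congr ?_ fun _ _ => rfl
  ext ⟨a, b, c⟩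
  simp only [Finset.mem_product, Finset.mem_filter, maskLE_univ, id, Nat.testBit_or,
    Bool.or_eq_true]
  grind

/-- Division by `z ^ n` is exact, and modulo `z` only the terms with exponent `n` survive, each as
`1`; there are fewer than `z` of them. -/
theorem sum_pow_div_pow_mod {ι : Type*} (F : Finset ι) (k : ι → ℕ) {n z : ℕ}
    (hk : ∀ x ∈ F, n ≤ k x) (hz : F.card < z) :
    (∑ x ∈ F, z ^ k x) / z ^ n % z = (F.filter fun x => k x = n).card := by
  have hz0 : 0 < z := by omega
  have h1 : ∑ x ∈ F, z ^ k x = z ^ n * ∑ x ∈ F, z ^ (k x - n) := by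
    rw [Finset.mul_sum]
    refine Finset.sum_congr rfl fun x hx => ?_
    rw [← pow_add, Nat.add_sub_cancel' (hk x hx)]
  have hlt : (F.filter fun x => k x = n).card < z := (Finset.card_filter_le _ _).trans_lt hz
  rw [h1, Nat.mul_div_cancel_left _ (by positivity), ← Nat.mod_eq_of_lt hlt]
  change _ ≡ _ [MOD z]
  rw [Finset.card_filter]
  rw [← ZMod.natCast_eq_natCast_iff]
  push_cast
  refine Finset.sum_congr rfl fun x hx => ?_
  split_ifs with h
  · simp [h]
  · have : k x - n ≠ 0 := by have := hk x hx; omega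
    simp [this]

/-! ### Counting domatic partitions -/

/-- The set of vertices that is encoded by a binary mask. -/
def maskSet (n S : ℕ) : Finset (Fin n) :=
  Finset.univ.filter fun v => S.testBit v = true

@[simp] theorem mem_maskSet {n S : ℕ} {v : Fin n} : v ∈ maskSet n S ↔ S.testBit v = true := by
  simp [maskSet]

theorem card_maskSet_le (n S : ℕ) : (maskSet n S).card ≤ n := by
  simpa using Finset.card_le_univ (maskSet n S)

theorem exists_maskSet_eq {n : ℕ} (D : Finset (Fin n)) : ∃ S < 2 ^ n, maskSet n S = D := by
  classical
  refine ⟨Nat.ofBits fun v => decide (v ∈ D), Nat.ofBits_lt_two_pow _, ?_⟩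
  ext v
  simp [Nat.testBit_ofBits_lt]

theorem maskSet_or (n S T : ℕ) : maskSet n (S ||| T) = maskSet n S ∪ maskSet n T := by
  ext v
  simp

theorem maskSet_eq_univ {n S : ℕ} (hS : S < 2 ^ n) :
    maskSet n S = Finset.univ ↔ S = 2 ^ n - 1 := by
  rw [← maskLE_Ici hS]
  simp only [Finset.ext_iff, mem_maskSet, Finset.mem_univ, iff_true, MaskLE, Set.mem_Ici, not_le,
    Nat.testBit_two_pow_sub_one, decide_eq_true_eq]
  constructor
  · refine fun h j => ⟨fun hj => ?_, fun hj _ => h ⟨j, hj⟩⟩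
    by_contra hjn
    rw [Nat.testBit_lt_two_pow (hS.trans_le (Nat.pow_le_pow_right (by norm_num) (by omega)))] at hj
    simp at hj
  · exact fun h v => (h v).2 v.2 v.2

theorem hasDomaticPartition_three_iff {n : ℕ} (G : SimpleGraph (Fin n)) :
    HasDomaticPartition G 3 ↔ ∃ A B C : Finset (Fin n),
      IsDominatingSet G (A : Set (Fin n)) ∧ IsDominatingSet G (B : Set (Fin n)) ∧
        IsDominatingSet G (C : Set (Fin n)) ∧ A ∪ (B ∪ C) = Finset.univ ∧
          A.card + (B.card + C.card) = n := by
  classical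
  constructor
  · rintro ⟨D, hU, hd, hD⟩
    refine ⟨(D 0).toFinset, (D 1).toFinset, (D 2).toFinset, by simpa using hD 0,
      by simpa using hD 1, by simpa using hD 2, ?_⟩
    have hu : (D 0).toFinset ∪ ((D 1).toFinset ∪ (D 2).toFinset) = Finset.univ := by
      ext v
      have : v ∈ ⋃ i, D i := hU ▸ Set.mem_univ v
      simpa [Fin.exists_fin_succ] using this
    refine ⟨hu, ?_⟩
    have h12 : Disjoint (D 1).toFinset (D 2).toFinset :=
      Set.disjoint_toFinset.2 (hd 1 2 (by decide))
    have h0 : Disjoint (D 0).toFinset ((D 1).toFinset ∪ (D 2).toFinset) :=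
      Finset.disjoint_union_right.2 ⟨Set.disjoint_toFinset.2 (hd 0 1 (by decide)),
        Set.disjoint_toFinset.2 (hd 0 2 (by decide))⟩
    rw [← Finset.card_union_of_disjoint h12, ← Finset.card_union_of_disjoint h0, hu]
    simp
  · rintro ⟨A, B, C, hA, hB, hC, hu, hc⟩
    have h1 := Finset.card_union_le B C
    have h2 := Finset.card_union_le A (B ∪ C)
    have h3 : (A ∪ (B ∪ C)).card = n := by simp [hu]
    -- The sizes sum to `n`, so both union bounds are equalities, which forces disjointness.
    have hBC : Disjoint B C := Finset.card_union_eq_card_add_card.1 (by omega)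
    have hABC : Disjoint A (B ∪ C) := Finset.card_union_eq_card_add_card.1 (by omega)
    rw [Finset.disjoint_union_right] at hABC
    refine ⟨![A, B, C], ?_, ?_, ?_⟩
    · ext v
      have : v ∈ A ∪ (B ∪ C) := hu ▸ Finset.mem_univ v
      simpa [Fin.exists_fin_succ] using this
    · intro i j hij
      fin_cases i <;> fin_cases j <;>
        simp_all [disjoint_comm]
    · intro i
      fin_cases i
      exacts [hA, hB, hC]

open Classical in
/-- The weight of a mask: `z ^ k` if it encodes a dominating set with `k` elements, and `0`
otherwise. -/
noncomputable def domWeight {n : ℕ} (G : SimpleGraph (Fin n)) (z S : ℕ) : ℕ :=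
  if IsDominatingSet G (maskSet n S : Set (Fin n)) then z ^ (maskSet n S).card else 0

theorem domWeight_le {n : ℕ} (G : SimpleGraph (Fin n)) {z : ℕ} (hz : 0 < z) (S : ℕ) :
    domWeight G z S ≤ z ^ n := by
  unfold domWeight
  split_ifs
  · exact Nat.pow_le_pow_right hz (card_maskSet_le n S)
  · exact Nat.zero_le _

/-- All triples of masks with `n` bits. -/
def maskTriples (n : ℕ) : Finset (ℕ × ℕ × ℕ) :=
  Finset.range (2 ^ n) ×ˢ Finset.range (2 ^ n) ×ˢ Finset.range (2 ^ n)

theorem card_maskTriples (n : ℕ) : (maskTriples n).card = 8 ^ n := by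
  simp [maskTriples, ← mul_pow]

/-- The sums over triples of masks of the product of their weights, restricted by the
union of the triple. -/
noncomputable def tripleSum {n : ℕ} (G : SimpleGraph (Fin n)) (z : ℕ) (J : Set ℕ) (S : ℕ) : ℕ :=
  maskSum (maskTriples n) (fun x => x.1 ||| x.2.1 ||| x.2.2)
    (fun x => domWeight G z x.1 * (domWeight G z x.2.1 * domWeight G z x.2.2)) J S

theorem tripleSum_le {n : ℕ} (G : SimpleGraph (Fin n)) {z : ℕ} (hz : 0 < z) (J : Set ℕ) (S : ℕ) :
    tripleSum G z J S ≤ 8 ^ n * z ^ (3 * n) := by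
  unfold tripleSum
  rw [← card_maskTriples]
  refine maskSum_le _ _ _ _ _ fun x _ => ?_
  calc _ ≤ z ^ n * (z ^ n * z ^ n) := by
        gcongr <;> exact domWeight_le G hz _
    _ = z ^ (3 * n) := by ring

theorem tripleSum_div_mod_ne_zero_iff {n : ℕ} (G : SimpleGraph (Fin n)) {z : ℕ} (hz : 8 ^ n < z) :
    tripleSum G z (Set.Ici n) (2 ^ n - 1) / z ^ n % z ≠ 0 ↔ HasDomaticPartition G 3 := by
  classical
  set F := (maskTriples n).filter fun x => x.1 ||| x.2.1 ||| x.2.2 = 2 ^ n - 1 ∧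
    IsDominatingSet G (maskSet n x.1 : Set (Fin n)) ∧
    IsDominatingSet G (maskSet n x.2.1 : Set (Fin n)) ∧
    IsDominatingSet G (maskSet n x.2.2 : Set (Fin n)) with hF
  have hlt : ∀ x ∈ maskTriples n, x.1 ||| x.2.1 ||| x.2.2 < 2 ^ n := by
    rintro ⟨a, b, c⟩ hx
    simp only [maskTriples, Finset.mem_product, Finset.mem_range] at hx
    exact Nat.or_lt_two_pow (Nat.or_lt_two_pow hx.1 hx.2.1) hx.2.2
  have hsum : tripleSum G z (Set.Ici n) (2 ^ n - 1) = ∑ x ∈ F, z ^ ((maskSet n x.1).card +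
      ((maskSet n x.2.1).card + (maskSet n x.2.2).card)) := by
    unfold tripleSum maskSum
    rw [hF, Finset.sum_filter, Finset.sum_filter]
    refine Finset.sum_congr rfl fun x hx => ?_
    rw [maskLE_Ici (hlt x hx)]
    simp only [domWeight, pow_add]
    split_ifs <;> simp_all
  have hk : ∀ x ∈ F, n ≤ (maskSet n x.1).card +
      ((maskSet n x.2.1).card + (maskSet n x.2.2).card) := by
    intro x hx
    rw [hF, Finset.mem_filter] at hx
    have hu := (maskSet_eq_univ (hlt x hx.1)).2 hx.2.1
    rw [maskSet_or, maskSet_or] at hu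
    have h1 := Finset.card_union_le (maskSet n x.1 ∪ maskSet n x.2.1) (maskSet n x.2.2)
    have h2 := Finset.card_union_le (maskSet n x.1) (maskSet n x.2.1)
    rw [hu, Finset.card_univ, Fintype.card_fin] at h1
    omega
  rw [hsum, sum_pow_div_pow_mod F _ hk, ← Nat.pos_iff_ne_zero, Finset.card_pos,
    hasDomaticPartition_three_iff]
  · constructor
    · rintro ⟨x, hx⟩
      rw [Finset.mem_filter, hF, Finset.mem_filter] at hx
      refine ⟨_, _, _, hx.1.2.2.1, hx.1.2.2.2.1, hx.1.2.2.2.2, ?_, hx.2⟩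
      rw [← Finset.union_assoc, ← maskSet_or, ← maskSet_or]
      exact (maskSet_eq_univ (hlt x hx.1.1)).2 hx.1.2.1
    · rintro ⟨A, B, C, hA, hB, hC, hu, hc⟩
      obtain ⟨a, ha, rfl⟩ := exists_maskSet_eq A
      obtain ⟨b, hb, rfl⟩ := exists_maskSet_eq B
      obtain ⟨c, hc', rfl⟩ := exists_maskSet_eq C
      have hx : (a, b, c) ∈ maskTriples n := by simp [maskTriples, ha, hb, hc']
      refine ⟨(a, b, c), Finset.mem_filter.2 ⟨Finset.mem_filter.2 ⟨hx, ?_, hA, hB, hC⟩, hc⟩⟩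
      rw [← maskSet_eq_univ (hlt _ hx), maskSet_or, maskSet_or, Finset.union_assoc, hu]
  · rw [← card_maskTriples] at hz
    exact (Finset.card_filter_le _ _).trans_lt hz

namespace RAM

/-! ### The memory layout -/

/-- The memory that holds the adjacency matrix of `G`, followed by the table `t`. -/
noncomputable def layout {n : ℕ} (G : SimpleGraph (Fin n)) (t : ℕ → ℕ) (a : ℕ) : ℕ :=
  if a < n * n then (graphInput G).mem a else t (a - n * n)

variable {n : ℕ} (G : SimpleGraph (Fin n))

@[simp] theorem layout_table (t : ℕ → ℕ) (S : ℕ) : layout G t (n * n + S) = t S := by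
  simp [layout]

theorem update_layout (t : ℕ → ℕ) (S v : ℕ) :
    Function.update (layout G t) (n * n + S) v = layout G (Function.update t S v) := by
  funext a
  by_cases ha : a < n * n
  · rw [Function.update_of_ne (by omega)]
    simp [layout, ha]
  · obtain ⟨b, rfl⟩ := Nat.exists_eq_add_of_le (not_lt.1 ha)
    by_cases hb : b = S
    · subst hb
      simp
    · rw [Function.update_of_ne (by omega)]
      simp [hb]

open Classical in
theorem layout_adj (t : ℕ → ℕ) (v u : Fin n) :
    layout G t (v * n + u) = if G.Adj v u then 1 else 0 := by
  have hlt : (v * n + u : ℕ) < n * n := by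
    have := v.2
    have := u.2
    nlinarith
  have hn : 0 < n := v.pos
  simp only [layout, hlt, if_true, graphInput]
  congr 1
  rw [eq_iff_iff]
  constructor
  · rintro ⟨i, j, hij, h⟩
    have h1 := congrArg (· / n) hij
    have h2 := congrArg (· % n) hij
    simp only [Nat.mul_comm _ n, Nat.mul_add_div hn, Nat.div_eq_of_lt, Fin.is_lt,
      Nat.mul_add_mod, Nat.mod_eq_of_lt, add_zero] at h1 h2
    rwa [Fin.ext h1, Fin.ext h2]
  · exact fun h => ⟨v, u, rfl, h⟩

theorem layout_zero : layout G (fun _ => 0) = (graphInput G).mem := by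
  funext a
  by_cases ha : a < n * n
  · simp [layout, ha]
  · simp only [layout, ha, if_false, graphInput]
    rw [if_neg]
    rintro ⟨i, j, rfl, -⟩
    have := i.2
    have := j.2
    apply ha
    nlinarith

theorem layout_le {t : ℕ → ℕ} {B : ℕ} (hB : 1 ≤ B) (ht : ∀ S, t S ≤ B) (a : ℕ) :
    layout G t a ≤ B := by
  unfold layout
  split_ifs
  · simp only [graphInput]
    split_ifs <;> omega
  · exact ht _

/-! ### Transforming the table in place -/

/-- The bit of register `x` at the position `i`, where register `p` holds `2 ^ i`. -/
def bitExpr (x p : ℕ) : Expr :=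
  .op .sub (.op .div (.reg x) (.reg p))
    (.op .mul (.const 2) (.op .div (.op .div (.reg x) (.reg p)) (.const 2)))

/-- The machine has no remainder operation; parity is `q - 2 * (q / 2)`. -/
theorem val_bitExpr (s : State) (x p : ℕ) :
    (bitExpr x p).val s = s.reg x / s.reg p % 2 := by
  simp only [bitExpr, Expr.val, Op.apply]
  omega

/-- The address of the table entry with index `e`. -/
def tableAddr (e : Expr) : Expr :=
  .op .add (.op .mul (.reg 0) (.reg 0)) e

theorem val_tableAddr (s : State) (e : Expr) :
    (tableAddr e).val s = s.reg 0 * s.reg 0 + e.val s := rfl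

/-- The registers between the phases of the program. -/
def restRegs (n z : ℕ) : List ℕ := [n, 2 ^ n, z, 0, 0, 1, 0, 1, 0, 0, 1]

/-- The number `B` bounds all numbers that occur in the computation with the base `z`. -/
structure RegBound (n z B : ℕ) : Prop where
  lt_z : 8 ^ n < z
  pow_z_le : z ^ (3 * n + 1) ≤ B

theorem RegBound.z_pos {n z B : ℕ} (h : RegBound n z B) : 0 < z :=
  (Nat.zero_le _).trans_lt h.lt_z

theorem RegBound.z_pow_le {n z B i : ℕ} (h : RegBound n z B) (hi : i ≤ 3 * n + 1) : z ^ i ≤ B :=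
  (Nat.pow_le_pow_right h.z_pos hi).trans h.pow_z_le

theorem RegBound.z_le {n z B : ℕ} (h : RegBound n z B) : z ≤ B := by
  simpa using h.z_pow_le (i := 1) (by omega)

theorem RegBound.pow_le {n z B : ℕ} (h : RegBound n z B) : 2 ^ n ≤ B :=
  (Nat.pow_le_pow_left (by norm_num) n).trans (h.lt_z.le.trans h.z_le)

theorem RegBound.one_le {n z B : ℕ} (h : RegBound n z B) : 1 ≤ B :=
  Nat.one_le_two_pow.trans h.pow_le

theorem RegBound.two_mul_le {n z B i : ℕ} (h : RegBound n z B) (hi : i ≤ n) : 2 * i ≤ B := by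
  have h1 : n < 2 ^ n := n.lt_two_pow_self
  have h2 : (8 : ℕ) ^ n = 2 ^ n * (2 ^ n * 2 ^ n) := by
    rw [← mul_pow, ← mul_pow]
    norm_num
  have := h.lt_z
  have := h.z_le
  nlinarith [Nat.one_le_two_pow (n := n)]

theorem RegBound.n_le {n z B : ℕ} (h : RegBound n z B) : n ≤ B :=
  n.lt_two_pow_self.le.trans h.pow_le

theorem RegBound.two_pow_le {n z B i : ℕ} (h : RegBound n z B) (hi : i ≤ n) : 2 ^ i ≤ B :=
  (Nat.pow_le_pow_right (by norm_num) hi).trans h.pow_le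

/-- For all positions `i` and all masks `S`, combine the entry of `S` with the entry of `S`
without `i`, provided that `i` belongs to `S`. -/
def transformProgram (o : Op) : Program :=
  .seq
    (forLoop 3 0
      (.seq
        (forLoop 4 1
          (.store (tableAddr (.reg 4))
            (.op o (.mem (tableAddr (.reg 4)))
              (.op .mul (bitExpr 4 5) (.mem (tableAddr (.op .sub (.reg 4) (.reg 5))))))))
        (.assign 5 (.op .mul (.const 2) (.reg 5)))))
    (.assign 5 (.const 1))

/-- Sweeping upwards in place is safe: the entry read at `S - 2 ^ i` has already been visited, but
its bit `i` is zero, so round `i` leaves it unchanged. Register `5` holds `2 ^ i`. -/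
theorem runs_transformProgram (o : Op) (ho : ∀ a, o.apply a 0 = a) {z B : ℕ}
    (hB : RegBound n z B) (h : ℕ → ℕ → ℕ) (hle : ∀ i S, h i S ≤ B)
    (h0 : ∀ i S, 2 ^ n ≤ S → h i S = 0)
    (hstep : ∀ i < n, ∀ S < 2 ^ n,
      h (i + 1) S = o.apply (h i S) (S / 2 ^ i % 2 * h i (S - 2 ^ i))) :
    Runs (transformProgram o) (mkState (restRegs n z) (layout G (h 0)))
      (mkState (restRegs n z) (layout G (h n))) ((n + 1) * ((2 ^ n + 1) * len B)) := by
  have hinner : ∀ i < n, ∀ S < 2 ^ n, S / 2 ^ i % 2 = 1 →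
      S - 2 ^ i < S ∧ h (i + 1) (S - 2 ^ i) = h i (S - 2 ^ i) := by
    intro i hi S hS hbit
    have hb : S.testBit i = true := by
      rw [Nat.testBit_eq_decide_div_mod_eq]
      simpa using hbit
    have hge := Nat.ge_two_pow_of_testBit hb
    refine ⟨Nat.sub_lt_of_pos_le (by positivity) hge, ?_⟩
    rw [hstep i hi _ ((Nat.sub_le _ _).trans_lt hS), ← Nat.toNat_testBit, Nat.testBit_sub_two_pow hb]
    simp [ho]
  -- The table in round `i` after the first `j` entries have been updated.
  set m : ℕ → ℕ → ℕ → ℕ := fun i j S => if S < j then h (i + 1) S else h i S with hm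
  have hmle : ∀ i j S, m i j S ≤ B := by
    intro i j S
    simp only [hm]
    split_ifs <;> exact hle _ _
  have hm0 : ∀ i, m i 0 = h i := by
    intro i
    funext S
    simp [hm]
  have hmN : ∀ i, m i (2 ^ n) = h (i + 1) := by
    intro i
    funext S
    by_cases hS : S < 2 ^ n
    · simp [hm, hS]
    · simp [hm, hS, h0 _ S (not_lt.1 hS)]
  refine Runs.seq (Runs.forLoop (N := n) (L := len B)
    (fun i => [n, 2 ^ n, z, i, 0, 2 ^ i, 0, 1, 0, 0, 1])
    (fun i => [n, 2 ^ n, z, i, 0, 2 ^ (i + 1), 0, 1, 0, 0, 1])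
    (fun i => layout G (h i)) ?_ ?_ ?_ ?_ ?_ ?_ ?_ ?_ ?_ ?_)
    (Runs.assign_const (L := len B) (bounded_mkState ?_ (layout_le G hB.one_le (hle n))) ?_ ?_)
  · intro i hi
    refine bounded_mkState ?_ (layout_le G hB.one_le (hle i))
    simp [hB.n_le, hB.one_le, hB.pow_le, hB.z_le, hB.two_pow_le hi, hi.trans hB.n_le]
  · intro i hi
    refine bounded_mkState ?_ (layout_le G hB.one_le (hle _))
    simp [hB.n_le, hB.one_le, hB.pow_le, hB.z_le, hB.two_pow_le (Nat.succ_le_of_lt hi),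
      hi.le.trans hB.n_le]
  · simp
  · simp
  · simp
  · simp
  · simp
  · simp
  · exact Nat.le_mul_of_pos_left _ (by positivity)
  · intro i hi
    refine Runs.seq (s' := mkState [n, 2 ^ n, z, i, 0, 2 ^ i, 0, 1, 0, 0, 1]
      (layout G (h (i + 1)))) ?_ ?_
    · simp only [← hm0 i, ← hmN i]
      refine Runs.forLoop (N := 2 ^ n) (L := len B)
        (fun j => [n, 2 ^ n, z, i, j, 2 ^ i, 0, 1, 0, 0, 1])
        (fun j => [n, 2 ^ n, z, i, j, 2 ^ i, 0, 1, 0, 0, 1])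
        (fun j => layout G (m i j)) ?_ ?_ ?_ ?_ ?_ ?_ ?_ ?_ le_rfl ?_
      · intro j hj
        refine bounded_mkState ?_ (layout_le G hB.one_le (hmle i j))
        simp [hB.n_le, hB.one_le, hB.pow_le, hB.z_le, hB.two_pow_le hi.le, hi.le.trans hB.n_le,
          hj.trans hB.pow_le]
      · intro j hj
        refine bounded_mkState ?_ (layout_le G hB.one_le (hmle i _))
        simp [hB.n_le, hB.one_le, hB.pow_le, hB.z_le, hB.two_pow_le hi.le, hi.le.trans hB.n_le,
          hj.le.trans hB.pow_le]
      · simp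
      · simp
      · simp
      · simp
      · simp
      · simp
      · intro j hj
        have hupd : layout G (m i (j + 1)) =
            Function.update (layout G (m i j)) (n * n + j) (h (i + 1) j) := by
          rw [update_layout]
          congr 1
          funext S
          rcases lt_trichotomy S j with hS | rfl | hS
          · rw [Function.update_of_ne hS.ne]
            simp [hm, hS, Nat.lt_succ_of_lt hS]
          · simp [hm]
          · rw [Function.update_of_ne hS.ne']
            simp [hm, show ¬ S < j + 1 by omega, show ¬ S < j by omega]
        simp only [hupd]
        refine Runs.store (L := len B) (bounded_mkState ?_ (layout_le G hB.one_le (hmle i j)))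
          rfl ?_ le_rfl
        · simp [hB.n_le, hB.one_le, hB.pow_le, hB.z_le, hB.two_pow_le hi.le,
            hi.le.trans hB.n_le, hj.le.trans hB.pow_le]
        · simp only [Expr.val, val_bitExpr, val_tableAddr]
          simp only [mkState, List.getD_cons_zero, List.getD_cons_succ, layout_table]
          change o.apply (m i j j) (j / 2 ^ i % 2 * m i j (j - 2 ^ i)) = _
          rw [hstep i hi j hj]
          have hjj : m i j j = h i j := by simp [hm]
          rw [hjj]
          rcases Nat.mod_two_eq_zero_or_one (j / 2 ^ i) with hb | hb
          · simp [hb]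
          · obtain ⟨h1, h2⟩ := hinner i hi j hj hb
            simp [hb, hm, h1, h2]
    · refine Runs.assign (L := len B) (v := 2 ^ (i + 1))
        (bounded_mkState ?_ (layout_le G hB.one_le (hle (i + 1)))) ?_ ?_ ?_
      · simp [hB.n_le, hB.one_le, hB.pow_le, hB.z_le, hB.two_pow_le hi.le, hi.le.trans hB.n_le]
      · simp
      · simp [Expr.val, Op.apply, mkState, pow_succ']
      · exact Nat.le_mul_of_pos_left _ (by positivity)
  · simp [hB.n_le, hB.one_le, hB.pow_le, hB.z_le]
  · simp
  · rw [← mul_assoc]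
    exact Nat.le_mul_of_pos_left _ (by positivity)

end RAM

namespace RAM

variable {n : ℕ} (G : SimpleGraph (Fin n))

/-! ### The weights of the masks -/

/-- The number of `u < k` in the mask `S` that are equal to `v` or adjacent to `v`. -/
noncomputable def domCount (S v k : ℕ) : ℕ :=
  ∑ u ∈ Finset.range k,
    ((graphInput G).mem (v * n + u) + (1 - ((u - v) + (v - u)))) * (S / 2 ^ u % 2)

/-- The contribution of the vertices below `k` to the weight of the mask `S`. -/
noncomputable def domProd (z S k : ℕ) : ℕ :=
  ∏ v ∈ Finset.range k, (1 - (1 - domCount G S v n)) * (1 + (z - 1) * (S / 2 ^ v % 2))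

theorem domCount_le (S v k : ℕ) : domCount G S v k ≤ 2 * k := by
  unfold domCount
  refine (Finset.sum_le_card_nsmul _ _ 2 fun u _ => ?_).trans (by simp [mul_comm])
  have h1 : (graphInput G).mem (v * n + u) ≤ 1 := by
    simp only [graphInput]
    split_ifs <;> omega
  have h2 : S / 2 ^ u % 2 ≤ 1 := by omega
  calc _ ≤ 2 * 1 := Nat.mul_le_mul (by omega) h2
    _ = 2 := rfl

theorem domProd_le {z : ℕ} (hz : 0 < z) (S k : ℕ) : domProd G z S k ≤ z ^ k := by
  unfold domProd
  refine (Finset.prod_le_pow_card _ _ z fun v _ => ?_).trans (by simp)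
  have h2 : S / 2 ^ v % 2 ≤ 1 := by omega
  calc _ ≤ 1 * (1 + (z - 1) * 1) := by
        gcongr
        omega
    _ = z := by omega

theorem domCount_ne_zero_iff (S : ℕ) (v : Fin n) :
    domCount G S v n ≠ 0 ↔ v ∈ maskSet n S ∨ ∃ u ∈ maskSet n S, G.Adj v u := by
  classical
  have h : domCount G S v n = ∑ u : Fin n,
      ((if G.Adj v u then 1 else 0) + if u = v then 1 else 0) * (S.testBit u).toNat := by
    unfold domCount
    rw [Finset.sum_range]
    refine Finset.sum_congr rfl fun u _ => ?_
    rw [← layout_zero, layout_adj, Nat.toNat_testBit]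
    congr 2
    -- With truncated subtraction `(u - v) + (v - u)` is the distance, so `1` minus it is the
    -- indicator of `u = v`.
    split_ifs with huv
    · simp [huv]
    · have := Fin.val_ne_of_ne huv
      omega
  rw [h, Ne, Finset.sum_eq_zero_iff, not_forall]
  simp only [mem_maskSet, Finset.mem_univ, true_imp_iff, mul_eq_zero, not_or]
  constructor
  · rintro ⟨u, h1, h2⟩
    have hu : S.testBit u = true := by simpa using h2
    by_cases huv : u = v
    · exact .inl (huv ▸ hu)
    · exact .inr ⟨u, hu, by simpa [huv] using h1⟩
  · rintro (hv | ⟨u, hu, huv⟩)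
    · exact ⟨v, by simp, by simp [hv]⟩
    · exact ⟨u, by simp [huv], by simp [hu]⟩

/-- Under truncation `1 - (1 - c)` is the indicator of `c ≠ 0`, and `1 + (z - 1) * b` is `z ^ b` for
a bit `b`. -/
theorem domProd_eq {z : ℕ} (hz : 0 < z) (S : ℕ) : domProd G z S n = domWeight G z S := by
  classical
  unfold domProd domWeight
  rw [Finset.prod_range]
  split_ifs with h
  · rw [← Finset.prod_const, maskSet, Finset.prod_filter]
    refine Finset.prod_congr rfl fun v _ => ?_
    have hv := (domCount_ne_zero_iff G S v).2 (by simpa using h v)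
    rw [← Nat.toNat_testBit, show 1 - (1 - domCount G S v n) = 1 by omega]
    cases S.testBit v <;> simp
    omega
  · simp only [IsDominatingSet, not_forall] at h
    obtain ⟨v, hv⟩ := h
    refine Finset.prod_eq_zero (Finset.mem_univ v) ?_
    have := (domCount_ne_zero_iff G S v).not.2 (by simpa using hv)
    rw [not_not] at this
    simp [this]

/-- Add to register `9` the contribution of the vertex in register `8` to the domination of the
vertex in register `6`, for the mask in register `4`. -/
def countProgram : Program :=
  .assign 9 (.op .add (.reg 9) (.op .mul
    (.op .add (.mem (.op .add (.op .mul (.reg 6) (.reg 0)) (.reg 8)))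
      (.op .sub (.const 1) (.op .add (.op .sub (.reg 8) (.reg 6)) (.op .sub (.reg 6) (.reg 8)))))
    (bitExpr 4 7)))

/-- Multiply register `10` by the contribution of the vertex in register `6` to the weight. -/
def vertexProgram : Program :=
  .seq (forLoop 8 0 (.seq countProgram (.assign 7 (.op .mul (.const 2) (.reg 7)))))
    (.seq (.assign 7 (.const 1))
      (.seq
        (.assign 10 (.op .mul (.reg 10) (.op .mul
          (.op .sub (.const 1) (.op .sub (.const 1) (.reg 9)))
          (.op .add (.const 1) (.op .mul (.op .sub (.reg 2) (.const 1)) (bitExpr 4 5))))))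
        (.seq (.assign 9 (.const 0)) (.assign 5 (.op .mul (.const 2) (.reg 5))))))

/-- Fill the table with the weights of all masks. -/
def weightProgram : Program :=
  forLoop 4 1
    (.seq (forLoop 6 0 vertexProgram)
      (.seq (.assign 5 (.const 1))
        (.seq (.store (tableAddr (.reg 4)) (.reg 10)) (.assign 10 (.const 1)))))


/-- Registers `5` and `7` carry `2 ^ v` and `2 ^ u` by repeated doubling, register `9` the running
count and register `10` the running product. -/
theorem runs_vertexProgram {z B : ℕ} (hB : RegBound n z B) {t : ℕ → ℕ} (ht : ∀ S, t S ≤ B)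
    {S v : ℕ} (hS : S < 2 ^ n) (hv : v < n) :
    Runs vertexProgram
      (mkState [n, 2 ^ n, z, 0, S, 2 ^ v, v, 1, 0, 0, domProd G z S v] (layout G t))
      (mkState [n, 2 ^ n, z, 0, S, 2 ^ (v + 1), v, 1, 0, 0, domProd G z S (v + 1)] (layout G t))
      ((n + 1) * len B) := by
  have hm := layout_le G hB.one_le ht
  have hA : len B ≤ (n + 1) * len B := Nat.le_mul_of_pos_left _ (by positivity)
  have hSB := hS.le.trans hB.pow_le
  have hvB := hv.le.trans hB.n_le
  have hpB := hB.two_pow_le hv.le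
  have hpB' := hB.two_pow_le (Nat.succ_le_of_lt hv)
  have hw := (domProd_le G hB.z_pos S v).trans (hB.z_pow_le (by omega))
  have hw' := (domProd_le G hB.z_pos S (v + 1)).trans (hB.z_pow_le (by omega))
  have hc : ∀ k ≤ n, domCount G S v k ≤ B := fun k hk =>
    (domCount_le G S v k).trans (hB.two_mul_le hk)
  refine Runs.seq (Runs.forLoop (N := n) (L := len B)
    (fun u => [n, 2 ^ n, z, 0, S, 2 ^ v, v, 2 ^ u, u, domCount G S v u, domProd G z S v])
    (fun u => [n, 2 ^ n, z, 0, S, 2 ^ v, v, 2 ^ (u + 1), u, domCount G S v (u + 1),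
      domProd G z S v])
    (fun _ => layout G t) ?_ ?_ ?_ ?_ ?_ ?_ ?_ ?_ le_rfl ?_)
    (Runs.seq (Runs.assign_const (L := len B) (bounded_mkState ?_ hm) ?_ hA)
      (Runs.seq (Runs.assign (L := len B) (v := domProd G z S (v + 1))
          (bounded_mkState ?_ hm) ?_ ?_ hA)
        (Runs.seq (Runs.assign_const (L := len B) (bounded_mkState ?_ hm) ?_ hA)
          (Runs.assign (L := len B) (v := 2 ^ (v + 1)) (bounded_mkState ?_ hm) ?_ ?_ hA))))
  · intro u hu
    refine bounded_mkState ?_ hm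
    simp [hB.n_le, hB.pow_le, hB.z_le, hSB, hvB, hpB, hw, hc u hu, hu.trans hB.n_le,
      hB.two_pow_le hu]
  · intro u hu
    refine bounded_mkState ?_ hm
    simp [hB.n_le, hB.pow_le, hB.z_le, hSB, hvB, hpB, hw, hc (u + 1) hu,
      hu.le.trans hB.n_le, hB.two_pow_le (Nat.succ_le_of_lt hu)]
  · simp
  · simp
  · simp
  · simp
  · simp
  · simp
  · intro u hu
    refine Runs.seq (Runs.assign (L := len B) (v := domCount G S v (u + 1))
      (bounded_mkState ?_ hm) ?_ ?_ le_rfl)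
      (Runs.assign (L := len B) (v := 2 ^ (u + 1)) (bounded_mkState ?_ hm) ?_ ?_ le_rfl)
    · simp [hB.n_le, hB.pow_le, hB.z_le, hSB, hvB, hpB, hw, hc u hu.le,
        hu.le.trans hB.n_le, hB.two_pow_le hu.le]
    · simp
    · have hlt : v * n + u < n * n := by nlinarith
      simp only [Expr.val, val_bitExpr]
      simp [mkState, Op.apply, layout, hlt, domCount, Finset.sum_range_succ]
    · simp [hB.n_le, hB.pow_le, hB.z_le, hSB, hvB, hpB, hw, hc (u + 1) hu,
        hu.le.trans hB.n_le, hB.two_pow_le hu.le]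
    · simp
    · simp [Expr.val, Op.apply, mkState, pow_succ']
  · simp [hB.n_le, hB.pow_le, hB.z_le, hSB, hvB, hpB, hw, hc n le_rfl]
  · simp
  · simp [hB.n_le, hB.one_le, hB.pow_le, hB.z_le, hSB, hvB, hpB, hw, hc n le_rfl]
  · simp
  · simp only [Expr.val, val_bitExpr]
    simp [mkState, Op.apply, domProd, Finset.prod_range_succ]
  · simp [hB.n_le, hB.one_le, hB.pow_le, hB.z_le, hSB, hvB, hpB, hw', hc n le_rfl]
  · simp
  · simp [hB.n_le, hB.one_le, hB.pow_le, hB.z_le, hSB, hvB, hpB, hw']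
  · simp
  · simp [Expr.val, Op.apply, mkState, pow_succ']

theorem runs_weightProgram {z B : ℕ} (hB : RegBound n z B) :
    Runs weightProgram (mkState (restRegs n z) (layout G fun _ => 0))
      (mkState (restRegs n z) (layout G fun S => if S < 2 ^ n then domWeight G z S else 0))
      ((2 ^ n + 1) * ((n + 1) * ((n + 1) * len B))) := by
  set m : ℕ → ℕ → ℕ := fun j S => if S < j then domWeight G z S else 0 with hm
  have hwB : ∀ S, domWeight G z S ≤ B := fun S =>
    (domWeight_le G hB.z_pos S).trans (hB.z_pow_le (by omega))
  have hmB : ∀ j S, m j S ≤ B := by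
    intro j S
    simp only [hm]
    split_ifs
    · exact hwB S
    · exact Nat.zero_le _
  have hm0 : (fun _ => 0) = m 0 := by
    funext S
    simp [hm]
  have hA : len B ≤ (n + 1) * ((n + 1) * len B) := by
    rw [← mul_assoc]
    exact Nat.le_mul_of_pos_left _ (by positivity)
  rw [hm0]
  refine Runs.forLoop (N := 2 ^ n) (L := len B)
    (fun j => [n, 2 ^ n, z, 0, j, 1, 0, 1, 0, 0, 1])
    (fun j => [n, 2 ^ n, z, 0, j, 1, 0, 1, 0, 0, 1])
    (fun j => layout G (m j)) ?_ ?_ ?_ ?_ ?_ ?_ ?_ ?_ hA ?_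
  · intro j hj
    refine bounded_mkState ?_ (layout_le G hB.one_le (hmB _))
    simp [hB.n_le, hB.one_le, hB.pow_le, hB.z_le, hj.trans hB.pow_le]
  · intro j hj
    refine bounded_mkState ?_ (layout_le G hB.one_le (hmB _))
    simp [hB.n_le, hB.one_le, hB.pow_le, hB.z_le, hj.le.trans hB.pow_le]
  · simp
  · simp
  · simp
  · simp
  · simp
  · simp
  · intro j hj
    have hjB := hj.le.trans hB.pow_le
    have hupd : layout G (m (j + 1)) =
        Function.update (layout G (m j)) (n * n + j) (domProd G z j n) := by
      rw [update_layout, domProd_eq G hB.z_pos]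
      congr 1
      funext S
      rcases lt_trichotomy S j with hS | rfl | hS
      · rw [Function.update_of_ne hS.ne]
        simp [hm, hS, Nat.lt_succ_of_lt hS]
      · simp [hm]
      · rw [Function.update_of_ne hS.ne']
        simp [hm, show ¬ S < j + 1 by omega, show ¬ S < j by omega]
    have hw : ∀ k ≤ n, domProd G z j k ≤ B := fun k hk =>
      (domProd_le G hB.z_pos j k).trans (hB.z_pow_le (by omega))
    have h0 : 1 = domProd G z j 0 := by simp [domProd]
    have hfirst : Runs (forLoop 6 0 vertexProgram)
        (mkState [n, 2 ^ n, z, 0, j, 1, 0, 1, 0, 0, 1] (layout G (m j)))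
        (mkState [n, 2 ^ n, z, 0, j, 2 ^ n, 0, 1, 0, 0, domProd G z j n] (layout G (m j)))
        ((n + 1) * ((n + 1) * len B)) := by
      have := Runs.forLoop (x := 6) (y := 0) (p := vertexProgram) (N := n) (L := len B)
        (A := (n + 1) * len B)
        (fun k => [n, 2 ^ n, z, 0, j, 2 ^ k, k, 1, 0, 0, domProd G z j k])
        (fun k => [n, 2 ^ n, z, 0, j, 2 ^ (k + 1), k, 1, 0, 0, domProd G z j (k + 1)])
        (fun _ => layout G (m j)) ?_ ?_ ?_ ?_ ?_ ?_ ?_ ?_ ?_ ?_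
      · simpa [← h0] using this
      · intro k hk
        refine bounded_mkState ?_ (layout_le G hB.one_le (hmB _))
        simp [hB.n_le, hB.one_le, hB.pow_le, hB.z_le, hjB, hB.two_pow_le hk, hk.trans hB.n_le,
          hw k hk]
      · intro k hk
        refine bounded_mkState ?_ (layout_le G hB.one_le (hmB _))
        simp [hB.n_le, hB.one_le, hB.pow_le, hB.z_le, hjB, hB.two_pow_le (Nat.succ_le_of_lt hk),
          hk.le.trans hB.n_le, hw (k + 1) hk]
      · simp
      · simp
      · simp
      · simp
      · simp
      · simp
      · exact Nat.le_mul_of_pos_left _ (by positivity)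
      · exact fun k hk => runs_vertexProgram G hB (hmB j) hj hk
    refine Runs.seq hfirst (Runs.seq
      (Runs.assign_const (L := len B) (bounded_mkState ?_ (layout_le G hB.one_le (hmB _))) ?_ hA)
      (Runs.seq (s' := mkState [n, 2 ^ n, z, 0, j, 1, 0, 1, 0, 0, domProd G z j n]
        (layout G (m (j + 1)))) ?_
        (Runs.assign_const (L := len B) (bounded_mkState ?_ (layout_le G hB.one_le (hmB _))) ?_ hA)))
    · simp [hB.n_le, hB.one_le, hB.pow_le, hB.z_le, hjB, hw n le_rfl]
    · simp
    · rw [hupd]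
      refine Runs.store (L := len B) (bounded_mkState ?_ (layout_le G hB.one_le (hmB _)))
        rfl rfl hA
      simp [hB.n_le, hB.one_le, hB.pow_le, hB.z_le, hjB, hw n le_rfl]
    · simp [hB.n_le, hB.one_le, hB.pow_le, hB.z_le, hjB, hw n le_rfl]
    · simp

/-! ### The remaining phases -/

/-- Compute `2 ^ n` and the base `8 ^ n + 1`, and initialize the registers that hold powers. -/
def initProgram : Program :=
  .seq (.assign 1 (.const 1))
    (.seq (forLoop 3 0 (.assign 1 (.op .mul (.const 2) (.reg 1))))
      (.seq (.assign 2 (.op .add (.op .mul (.op .mul (.reg 1) (.reg 1)) (.reg 1)) (.const 1)))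
        (.seq (.assign 5 (.const 1)) (.seq (.assign 7 (.const 1)) (.assign 10 (.const 1))))))

theorem graphInput_eq :
    graphInput G = mkState [n, 0, 0, 0, 0, 0, 0, 0, 0, 0, 0] (layout G fun _ => 0) := by
  rw [layout_zero]
  simp only [graphInput, mkState, State.mk.injEq, and_true]
  funext x
  rcases x with _ | x
  · simp
  · have : ∀ k y : ℕ, (List.replicate k 0).getD y 0 = 0 := by
      intro k y
      simp [List.getD, List.getElem?_replicate]
      split_ifs <;> rfl
    simpa using (this 10 x).symm

theorem runs_initProgram {B : ℕ} (hB : RegBound n (8 ^ n + 1) B) :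
    Runs initProgram (graphInput G) (mkState (restRegs n (8 ^ n + 1)) (layout G fun _ => 0))
      ((n + 1) * len B) := by
  rw [graphInput_eq]
  have hm := layout_le G (t := fun _ => 0) hB.one_le fun _ => Nat.zero_le _
  have hA : len B ≤ (n + 1) * len B := Nat.le_mul_of_pos_left _ (by positivity)
  refine Runs.seq (Runs.assign_const (L := len B) (bounded_mkState ?_ hm) ?_ hA)
    (Runs.seq (Runs.forLoop (N := n) (L := len B)
      (fun i => [n, 2 ^ i, 0, i, 0, 0, 0, 0, 0, 0, 0])
      (fun i => [n, 2 ^ (i + 1), 0, i, 0, 0, 0, 0, 0, 0, 0])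
      (fun _ => layout G fun _ => 0) ?_ ?_ ?_ ?_ ?_ ?_ ?_ ?_ le_rfl ?_)
    (Runs.seq (Runs.assign (L := len B) (v := 8 ^ n + 1) (bounded_mkState ?_ hm) ?_ ?_ hA)
      (Runs.seq (Runs.assign_const (L := len B) (bounded_mkState ?_ hm) ?_ hA)
        (Runs.seq (Runs.assign_const (L := len B) (bounded_mkState ?_ hm) ?_ hA)
          (Runs.assign_const (L := len B) (bounded_mkState ?_ hm) ?_ hA)))))
  · simp [hB.n_le]
  · simp
  · intro i hi
    refine bounded_mkState ?_ hm
    simp [hB.n_le, hB.two_pow_le hi, hi.trans hB.n_le]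
  · intro i hi
    refine bounded_mkState ?_ hm
    simp [hB.n_le, hB.two_pow_le (Nat.succ_le_of_lt hi), hi.le.trans hB.n_le]
  · simp
  · simp
  · simp
  · simp
  · simp
  · simp
  · intro i hi
    refine Runs.assign (L := len B) (v := 2 ^ (i + 1)) (bounded_mkState ?_ hm) ?_ ?_ le_rfl
    · simp [hB.n_le, hB.two_pow_le hi.le, hi.le.trans hB.n_le]
    · simp
    · simp [Expr.val, Op.apply, mkState, pow_succ']
  · simp [hB.n_le, hB.pow_le]
  · simp
  · simp [Expr.val, Op.apply, mkState, ← mul_pow]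
  · simp [hB.n_le, hB.pow_le, hB.z_le]
  · simp
  · simp [hB.n_le, hB.pow_le, hB.z_le, hB.one_le]
  · simp
  · simp [hB.n_le, hB.pow_le, hB.z_le, hB.one_le]
  · simp

/-- Replace all entries of the table by their cubes. -/
def cubeProgram : Program :=
  forLoop 4 1 (.store (tableAddr (.reg 4)) (.op .mul (.op .mul
    (.mem (tableAddr (.reg 4))) (.mem (tableAddr (.reg 4)))) (.mem (tableAddr (.reg 4)))))

theorem runs_cubeProgram {z B : ℕ} (hB : RegBound n z B) {t t' : ℕ → ℕ} (ht : ∀ S, t S ≤ B)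
    (ht' : ∀ S, t' S ≤ B) (hlt : ∀ S < 2 ^ n, t' S = t S * t S * t S)
    (hge : ∀ S, 2 ^ n ≤ S → t' S = t S) :
    Runs cubeProgram (mkState (restRegs n z) (layout G t)) (mkState (restRegs n z) (layout G t'))
      ((2 ^ n + 1) * len B) := by
  set m : ℕ → ℕ → ℕ := fun j S => if S < j then t' S else t S with hm
  have hmB : ∀ j S, m j S ≤ B := by
    intro j S
    simp only [hm]
    split_ifs
    · exact ht' S
    · exact ht S
  have hm0 : t = m 0 := by
    funext S
    simp [hm]
  have hmN : t' = m (2 ^ n) := by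
    funext S
    by_cases hS : S < 2 ^ n
    · simp [hm, hS]
    · simp [hm, hS, hge S (not_lt.1 hS)]
  have hrun : Runs cubeProgram (mkState (restRegs n z) (layout G (m 0)))
      (mkState (restRegs n z) (layout G (m (2 ^ n)))) ((2 ^ n + 1) * len B) := by
    refine Runs.forLoop (N := 2 ^ n) (L := len B)
      (fun j => [n, 2 ^ n, z, 0, j, 1, 0, 1, 0, 0, 1])
      (fun j => [n, 2 ^ n, z, 0, j, 1, 0, 1, 0, 0, 1])
      (fun j => layout G (m j)) ?_ ?_ ?_ ?_ ?_ ?_ ?_ ?_ le_rfl ?_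
    · intro j hj
      refine bounded_mkState ?_ (layout_le G hB.one_le (hmB _))
      simp [hB.n_le, hB.one_le, hB.pow_le, hB.z_le, hj.trans hB.pow_le]
    · intro j hj
      refine bounded_mkState ?_ (layout_le G hB.one_le (hmB _))
      simp [hB.n_le, hB.one_le, hB.pow_le, hB.z_le, hj.le.trans hB.pow_le]
    · simp
    · simp
    · simp
    · simp
    · simp
    · simp
    · intro j hj
      have hupd : layout G (m (j + 1)) =
          Function.update (layout G (m j)) (n * n + j) (t' j) := by
        rw [update_layout]
        congr 1
        funext S
        rcases lt_trichotomy S j with hS | rfl | hS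
        · rw [Function.update_of_ne hS.ne]
          simp [hm, hS, Nat.lt_succ_of_lt hS]
        · simp [hm]
        · rw [Function.update_of_ne hS.ne']
          simp [hm, show ¬ S < j + 1 by omega, show ¬ S < j by omega]
      simp only [hupd]
      refine Runs.store (L := len B) (bounded_mkState ?_ (layout_le G hB.one_le (hmB _)))
        rfl ?_ le_rfl
      · simp [hB.n_le, hB.one_le, hB.pow_le, hB.z_le, hj.le.trans hB.pow_le]
      · simp only [Expr.val, val_tableAddr]
        simp [mkState, layout_table, Op.apply, hm, hlt j hj]
  rwa [← hm0, ← hmN] at hrun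

/-- Write to register `0` whether the coefficient of `z ^ n` in the base-`z` expansion of the last
entry of the table is nonzero. -/
def answerProgram : Program :=
  .seq (forLoop 3 0 (.assign 10 (.op .mul (.reg 10) (.reg 2))))
    (.seq
      (.assign 9 (.op .div (.mem (tableAddr (.op .sub (.reg 1) (.const 1)))) (.reg 10)))
      (.assign 0 (.op .sub (.const 1) (.op .sub (.const 1)
        (.op .sub (.reg 9) (.op .mul (.reg 2) (.op .div (.reg 9) (.reg 2))))))))

theorem runs_answerProgram {z B : ℕ} (hB : RegBound n z B) {t : ℕ → ℕ} (ht : ∀ S, t S ≤ B) :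
    ∃ s, Runs answerProgram (mkState (restRegs n z) (layout G t)) s ((n + 1) * len B) ∧
      s.reg 0 = 1 - (1 - t (2 ^ n - 1) / z ^ n % z) := by
  have hm := layout_le G hB.one_le ht
  have hA : len B ≤ (n + 1) * len B := Nat.le_mul_of_pos_left _ (by positivity)
  have hzB := hB.z_pow_le (i := n) (by omega)
  have hcB : t (2 ^ n - 1) / z ^ n ≤ B := (Nat.div_le_self _ _).trans (ht _)
  refine ⟨mkState [1 - (1 - t (2 ^ n - 1) / z ^ n % z), 2 ^ n, z, 0, 0, 1, 0, 1, 0,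
    t (2 ^ n - 1) / z ^ n, z ^ n] (layout G t), ?_, rfl⟩
  refine Runs.seq (Runs.forLoop (N := n) (L := len B)
      (fun i => [n, 2 ^ n, z, i, 0, 1, 0, 1, 0, 0, z ^ i])
      (fun i => [n, 2 ^ n, z, i, 0, 1, 0, 1, 0, 0, z ^ (i + 1)])
      (fun _ => layout G t) ?_ ?_ ?_ ?_ ?_ ?_ ?_ ?_ le_rfl ?_)
    (Runs.seq (Runs.assign (L := len B) (v := t (2 ^ n - 1) / z ^ n)
        (bounded_mkState ?_ hm) ?_ ?_ hA)
      (Runs.assign (L := len B) (v := 1 - (1 - t (2 ^ n - 1) / z ^ n % z))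
        (bounded_mkState ?_ hm) ?_ ?_ hA))
  · intro i hi
    refine bounded_mkState ?_ hm
    simp [hB.n_le, hB.one_le, hB.pow_le, hB.z_le, hi.trans hB.n_le,
      hB.z_pow_le (i := i) (by omega)]
  · intro i hi
    refine bounded_mkState ?_ hm
    simp [hB.n_le, hB.one_le, hB.pow_le, hB.z_le, hi.le.trans hB.n_le,
      hB.z_pow_le (i := i + 1) (by omega)]
  · simp
  · simp
  · simp
  · simp
  · simp
  · simp
  · intro i hi
    refine Runs.assign (L := len B) (v := z ^ (i + 1)) (bounded_mkState ?_ hm) ?_ ?_ le_rfl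
    · simp [hB.n_le, hB.one_le, hB.pow_le, hB.z_le, hi.le.trans hB.n_le,
        hB.z_pow_le (i := i) (by omega)]
    · simp
    · simp [Expr.val, Op.apply, mkState, pow_succ]
  · simp [hB.n_le, hB.one_le, hB.pow_le, hB.z_le, hzB]
  · simp
  · simp only [Expr.val, val_tableAddr]
    simp [mkState, Op.apply]
  · simp [hB.n_le, hB.one_le, hB.pow_le, hB.z_le, hzB, hcB]
  · simp
  · simp [Expr.val, Op.apply, mkState, Nat.mod_eq_sub]

end RAM

namespace RAM

/-! ### The algorithm -/

theorem maskSum_le_of_regBound {n z B : ℕ} (G : SimpleGraph (Fin n)) (hB : RegBound n z B)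
    (J : Set ℕ) (S : ℕ) : maskSum (Finset.range (2 ^ n)) id (domWeight G z) J S ≤ B := by
  refine (maskSum_le _ _ _ _ _ fun S _ => domWeight_le G hB.z_pos S).trans ?_
  rw [Finset.card_range]
  refine le_trans ?_ (hB.z_pow_le (i := n + 1) (by omega))
  rw [pow_succ']
  exact Nat.mul_le_mul_right _
    ((Nat.pow_le_pow_left (by norm_num) n).trans hB.lt_z.le)

theorem tripleSum_le_of_regBound {n z B : ℕ} (G : SimpleGraph (Fin n)) (hB : RegBound n z B)
    (J : Set ℕ) (S : ℕ) : tripleSum G z J S ≤ B := by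
  refine (tripleSum_le G hB.z_pos J S).trans (le_trans ?_ hB.pow_z_le)
  rw [pow_succ']
  exact Nat.mul_le_mul_right _ hB.lt_z.le

/-- Compute for every set of vertices the sum of the weights of the dominating subsets, cube these
sums, invert the summation over subsets, and read off the answer. -/
def domaticProgram : Program :=
  .seq initProgram (.seq weightProgram (.seq (transformProgram .add)
    (.seq cubeProgram (.seq (transformProgram .sub) answerProgram))))

theorem runs_domaticProgram {n B : ℕ} (G : SimpleGraph (Fin n))
    (hB : RegBound n (8 ^ n + 1) B) :
    ∃ s, Runs domaticProgram (graphInput G) s ((2 ^ n + 1) * ((n + 1) * ((n + 1) * len B))) ∧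
      s.reg 0 = 1 - (1 - tripleSum G (8 ^ n + 1) (Set.Ici n) (2 ^ n - 1) /
        (8 ^ n + 1) ^ n % (8 ^ n + 1)) := by
  set z := 8 ^ n + 1 with hz
  -- `f` frees the positions below `i` one by one; `g` starts with all positions free and freezes
  -- them again.
  set f : ℕ → ℕ → ℕ := fun i S => if S < 2 ^ n then
    maskSum (Finset.range (2 ^ n)) id (domWeight G z) (Set.Iio i) S else 0 with hf
  set g : ℕ → ℕ → ℕ := fun i S => if S < 2 ^ n then tripleSum G z (Set.Ici i) S else 0 with hg
  have hfB : ∀ i S, f i S ≤ B := by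
    intro i S
    simp only [hf]
    split_ifs
    · exact maskSum_le_of_regBound G hB _ _
    · exact Nat.zero_le _
  have hgB : ∀ i S, g i S ≤ B := by
    intro i S
    simp only [hg]
    split_ifs
    · exact tripleSum_le_of_regBound G hB _ _
    · exact Nat.zero_le _
  have hf0 : (fun S => if S < 2 ^ n then domWeight G z S else 0) = f 0 := by
    classical
    funext S
    simp only [hf]
    split_ifs with hS
    · simp [maskSum, maskLE_empty, hS]
    · rfl
  have hfs : ∀ i < n, ∀ S < 2 ^ n,
      f (i + 1) S = Op.add.apply (f i S) (S / 2 ^ i % 2 * f i (S - 2 ^ i)) := by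
    intro i _ S hS
    have hJ : Set.Iio (i + 1) = insert i (Set.Iio i) := by
      ext j
      simp only [Set.mem_Iio, Set.mem_insert_iff]
      omega
    simp only [hf, hS, (Nat.sub_le S (2 ^ i)).trans_lt hS, if_true, Op.apply]
    rw [hJ, maskSum_insert _ _ _ (by simp)]
  -- Truncated subtraction is exact here, as every intermediate entry is itself a sum of natural
  -- numbers to which the subtracted term was added.
  have hgs : ∀ i < n, ∀ S < 2 ^ n,
      g (i + 1) S = Op.sub.apply (g i S) (S / 2 ^ i % 2 * g i (S - 2 ^ i)) := by
    intro i _ S hS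
    have hJ : Set.Ici i = insert i (Set.Ici (i + 1)) := by
      ext j
      simp only [Set.mem_Ici, Set.mem_insert_iff]
      omega
    simp only [hg, hS, (Nat.sub_le S (2 ^ i)).trans_lt hS, if_true, Op.apply]
    unfold tripleSum
    rw [hJ, maskSum_insert _ _ _ (by simp), maskSum_insert _ _ _ (by simp)]
    cases hb : S.testBit i
    · simp [← Nat.toNat_testBit, hb]
    -- The subtracted entry still has `i` free, but `S - 2 ^ i` lacks `i`, so freezing `i` does not
    -- change it.
    · simp [← Nat.toNat_testBit, hb, Nat.testBit_sub_two_pow hb]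
  have hcube : ∀ S < 2 ^ n, g 0 S = f n S * f n S * f n S := by
    intro S hS
    have h0 : Set.Ici (0 : ℕ) = Set.univ := by
      ext
      simp
    have h1 : maskSum (Finset.range (2 ^ n)) id (domWeight G z) (Set.Iio n) S =
        maskSum (Finset.range (2 ^ n)) id (domWeight G z) Set.univ S := by
      classical
      exact Finset.sum_congr (Finset.filter_congr fun x _ => maskLE_Iio hS) fun _ _ => rfl
    simp only [hf, hg, hS, if_true]
    rw [h1, maskSum_cube, h0]
    rfl
  obtain ⟨s, hs, hs0⟩ := runs_answerProgram G hB (hgB n)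
  have hlast : g n (2 ^ n - 1) = tripleSum G z (Set.Ici n) (2 ^ n - 1) := by
    simp [hg]
  rw [hlast] at hs0
  have hweight := runs_weightProgram G hB
  rw [hf0] at hweight
  have hA1 : (n + 1) * len B ≤ (2 ^ n + 1) * ((n + 1) * ((n + 1) * len B)) := by
    rw [← mul_assoc]
    exact Nat.le_mul_of_pos_left _ (by positivity)
  have hA2 : (n + 1) * ((2 ^ n + 1) * len B) ≤
      (2 ^ n + 1) * ((n + 1) * ((n + 1) * len B)) := by
    rw [show (2 ^ n + 1) * ((n + 1) * ((n + 1) * len B)) =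
      (n + 1) * ((n + 1) * ((2 ^ n + 1) * len B)) by ring]
    exact Nat.le_mul_of_pos_left _ (by positivity)
  have hA3 : (2 ^ n + 1) * len B ≤ (2 ^ n + 1) * ((n + 1) * ((n + 1) * len B)) :=
    le_trans (Nat.le_mul_of_pos_left _ (by positivity)) hA2
  refine ⟨s, ?_, hs0⟩
  exact ((runs_initProgram G hB).mono hA1).seq (hweight.seq
    (((runs_transformProgram G .add (fun _ => rfl) hB f hfB
      (fun i S hS => by simp [hf, not_lt.2 hS]) hfs).mono hA2).seq
    (((runs_cubeProgram G hB (hfB n) (hgB 0) hcube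
      (fun S hS => by simp [hf, hg, not_lt.2 hS])).mono hA3).seq
    (((runs_transformProgram G .sub (fun _ => rfl) hB g hgB
      (fun i S hS => by simp [hg, not_lt.2 hS]) hgs).mono hA2).seq (hs.mono hA1)))))

/-- The base is at most `2 ^ (3 * n + 1)`, so the power is at most `2 ^ ((3 * n + 1) ^ 2)`. -/
theorem len_regBound_le (n : ℕ) :
    len ((8 ^ n + 1) ^ (3 * n + 1)) ≤ (3 * n + 1) ^ 2 + 3 * n + 3 := by
  have h : Nat.size ((8 ^ n + 1) ^ (3 * n + 1)) ≤ (3 * n + 1) ^ 2 + 1 := by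
    rw [Nat.size_le]
    have h1 : 8 ^ n + 1 ≤ 2 ^ (3 * n + 1) := by
      rw [pow_succ, pow_mul]
      have : 1 ≤ (8 : ℕ) ^ n := Nat.one_le_pow _ _ (by norm_num)
      norm_num
    calc (8 ^ n + 1) ^ (3 * n + 1) ≤ (2 ^ (3 * n + 1)) ^ (3 * n + 1) :=
          Nat.pow_le_pow_left h1 _
      _ = 2 ^ ((3 * n + 1) ^ 2) := by rw [← pow_mul, sq]
      _ < 2 ^ ((3 * n + 1) ^ 2 + 1) := Nat.pow_lt_pow_right (by norm_num) (by omega)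
  unfold len
  omega

end RAM

theorem theorem1 :
    ∃ (p : RAM.Program) (T : ℕ → ℕ),
      RAM.DecidesInTime p (fun _ G => HasDomaticPartition G 3) T ∧
        IsSoftO (fun n => (T n : ℝ)) (fun n => (2.9416 : ℝ) ^ n) := by
  refine ⟨RAM.domaticProgram, fun n => RAM.domaticProgram.costFactor *
    ((2 ^ n + 1) * ((n + 1) * ((n + 1) * ((3 * n + 1) ^ 2 + 3 * n + 3)))), ?_, ?_⟩
  · intro n G
    -- This `B` covers the largest sums: at most `8 ^ n < z` triples, each of weight at most `z ^ (3
    -- * n)`.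
    obtain ⟨s, ⟨t, ht, he⟩, hs⟩ := RAM.runs_domaticProgram (B := (8 ^ n + 1) ^ (3 * n + 1)) G
      ⟨Nat.lt_succ_self _, le_rfl⟩
    refine ⟨s, t, he, ht.trans ?_, ?_⟩
    · have := RAM.len_regBound_le n
      dsimp only
      gcongr
    · have h := tripleSum_div_mod_ne_zero_iff G (Nat.lt_succ_self (8 ^ n))
      rw [hs]
      by_cases hG : HasDomaticPartition G 3
      · have := h.2 hG
        simp only [hG, if_true]
        simp only [Nat.succ_eq_add_one] at this
        omega
      · have := h.not.2 hG
        rw [not_not] at this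
        simp only [hG, if_false]
        simp only [Nat.succ_eq_add_one] at this
        omega
  · refine ⟨Polynomial.C (2 * (RAM.domaticProgram.costFactor : ℝ)) * ((Polynomial.X + 1) *
      ((Polynomial.X + 1) * ((3 * Polynomial.X + 1) ^ 2 + 3 * Polynomial.X + 3))), ?_⟩
    refine Asymptotics.IsBigO.of_bound 1 (Filter.Eventually.of_forall fun n => ?_)
    have h2 : (2 : ℝ) ^ n + 1 ≤ 2 * 2.9416 ^ n := by
      have h3 : (2 : ℝ) ^ n ≤ 2.9416 ^ n := pow_le_pow_left₀ (by norm_num) (by norm_num) n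
      have h4 : (1 : ℝ) ≤ 2.9416 ^ n := one_le_pow₀ (by norm_num)
      linarith
    simp only [Polynomial.eval_mul, Polynomial.eval_add, Polynomial.eval_pow, Polynomial.eval_C,
      Polynomial.eval_X, Polynomial.eval_one, Polynomial.eval_ofNat, one_mul]
    rw [Real.norm_of_nonneg (by positivity), Real.norm_of_nonneg (by positivity)]
    push_cast
    calc _ ≤ (RAM.domaticProgram.costFactor : ℝ) * ((2 * 2.9416 ^ n) *
          ((n + 1) * ((n + 1) * ((3 * n + 1) ^ 2 + 3 * n + 3)))) := by gcongr
      _ = _ := by ring
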